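/- Let $X$ be a real Banach space of finite cotype, i.e. there are $2\le q<\infty$ and a constant $C$ such that $$\Big(\sum_{j=1}^n\|x_j\|^q\Big)^{1/q}\le C\Big(\operatorname*{Ave}_{\varepsilon_j=\pm1}\Big\|\sum_{j=1}^n\varepsilon_jx_j\Big\|^q\Big)^{1/q}$$ for all $n\in\mathbb N$ and $x_1,\dots,x_n\in X$. Let $(e_n)_{n=1}^\infty$ be a normalized Schauder basis of $X$ ($\|e_n\|=1$ for all $n$) with biorthogonal functionals $(e_n^*)$. A weight is a sequence $w=(w_n)_{n=1}^\infty$ of positive real numbers; for a finite set $A\subset\mathbb N$ put $w(A)=\sum_{n\in A}w_n$, and for $x\in X$ and $y>0$ put $$\sigma^w_y(x)=\inf\Big\{\Big\|x-\sum_{n\in A}a_ne_n\Big\| : A\subset\mathbb N\text{ finite},\ w(A)\le y,\ a_n\in\mathbb R\Big\}.$$ The basis $(e_n)$ is called $w$-semi-greedy if there is a constant $K$ such that for every $x\in X$, every $m\ge1$ and every set $\Lambda$ of indices of $m$ largest coefficients of $x$ (that is, $|\Lambda|=m$ and $|e_k^*(x)|\le|e_n^*(x)|$ whenever $n\in\Lambda$,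 $k\notin\Lambda$), $$\min\Big\{\Big\|x-\sum_{n\in\Lambda}a_ne_n\Big\| : a_n\in\mathbb R\Big\}\le K\,\sigma^w_{w(\Lambda)}(x).$$ It is called semi-greedy if it is $w$-semi-greedy for the constant weight $w=(1,1,1,\dots)$. Then $(e_n)$ is $w$-semi-greedy for some weight $w$ if and only if $(e_n)$ is semi-greedy. -/

import Mathlib

open Finset

noncomputable section

/-- `X` has cotype `q`: there is a constant `C` such that
`(∑ ‖x j‖ ^ q) ^ (1 / q) ≤ C * (Ave_ε ‖∑ ε j • x j‖ ^ q) ^ (1 / q)` for all finite families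
`x 0, …, x (n - 1)` in `X`, the average being over the `2 ^ n` choices of signs `ε j = ±1`. -/
def HasCotype (X : Type*) [NormedAddCommGroup X] [NormedSpace ℝ X] (q : ℝ) : Prop :=
  ∃ C : ℝ, ∀ (n : ℕ) (x : Fin n → X),
    (∑ j, ‖x j‖ ^ q) ^ (1 / q) ≤
      C * ((∑ ε : Fin n → ℤˣ, ‖∑ j, ((ε j : ℤ) : ℝ) • x j‖ ^ q) / (2 : ℝ) ^ n) ^ (1 / q)

/-- `X` has finite cotype: it has cotype `q` for some `2 ≤ q < ∞`. -/
def HasFiniteCotype (X : Type*) [NormedAddCommGroup X] [NormedSpace ℝ X] : Prop :=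
  ∃ q : ℝ, 2 ≤ q ∧ HasCotype X q

/-- The `w`-measure `w(A) = ∑_{i ∈ A} w i` of a finite set of indices. -/
def wMeasure (w : ℕ → ℝ) (A : Finset ℕ) : ℝ := ∑ i ∈ A, w i

/-- A weight is a sequence of positive real numbers. -/
def IsWeight (w : ℕ → ℝ) : Prop := ∀ i, 0 < w i

section

variable {X : Type*} [NormedAddCommGroup X] [NormedSpace ℝ X]

/-- `Λ` is a set of indices of `Λ.card` largest coefficients of `x` in absolute value, that is, one
of the sets `{ρ 1, …, ρ m}`, `m = Λ.card`, for a greedy ordering `ρ` of the coefficients of `x`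
(ties may be broken in any way). -/
def IsGreedySet (b : SchauderBasis ℝ X) (x : X) (Λ : Finset ℕ) : Prop :=
  ∀ n ∈ Λ, ∀ k ∉ Λ, |b.coord k x| ≤ |b.coord n x|

/-- `g` is a Chebyshev approximation to `x` from the span of the basis vectors indexed by `Λ`:
a point of that span at minimal distance from `x`. -/
def IsChebyshevApprox (b : SchauderBasis ℝ X) (x : X) (Λ : Finset ℕ) (g : X) : Prop :=
  g ∈ Submodule.span ℝ (b.basis '' (Λ : Set ℕ)) ∧
    ∀ z ∈ Submodule.span ℝ (b.basis '' (Λ : Set ℕ)), ‖x - g‖ ≤ ‖x - z‖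

/-- Chebyshev approximations always exist. -/
theorem exists_isChebyshevApprox (b : SchauderBasis ℝ X) (x : X) (Λ : Finset ℕ) :
    ∃ g, IsChebyshevApprox b x Λ g := by
  have hfin : FiniteDimensional ℝ (Submodule.span ℝ (b.basis '' (Λ : Set ℕ))) :=
    FiniteDimensional.span_of_finite ℝ (Λ.finite_toSet.image _)
  have : ProperSpace (Submodule.span ℝ (b.basis '' (Λ : Set ℕ))) :=
    FiniteDimensional.proper_real _
  have hcont : Continuous
      (fun z : Submodule.span ℝ (b.basis '' (Λ : Set ℕ)) => ‖x - (z : X)‖) := by fun_prop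
  have hlim : Filter.Tendsto
      (fun z : Submodule.span ℝ (b.basis '' (Λ : Set ℕ)) => ‖x - (z : X)‖)
      (Filter.cocompact _) Filter.atTop := by
    refine Filter.tendsto_atTop_mono (fun z => ?_)
      (Filter.tendsto_atTop_add_const_right _ (-‖x‖) (tendsto_norm_cocompact_atTop))
    have h := norm_sub_norm_le (z : X) x
    rw [norm_sub_rev] at h
    simpa [sub_eq_add_neg] using h
  obtain ⟨g, hg⟩ := hcont.exists_forall_le hlim
  exact ⟨g, g.2, fun z hz => hg ⟨z, hz⟩⟩

/-- `σ^w_y(x)`: the error in the best approximation to `x` by vectors supported on a finite set of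
indices of `w`-measure at most `y`. -/
def bestApproxError (b : SchauderBasis ℝ X) (w : ℕ → ℝ) (y : ℝ) (x : X) : ℝ :=
  sInf {r : ℝ | ∃ (A : Finset ℕ) (a : ℕ → ℝ),
    wMeasure w A ≤ y ∧ r = ‖x - ∑ n ∈ A, a n • b.basis n‖}

/-- The basis is `w`-semi-greedy: for some constant `K`, whenever `Λ` is a set of indices of
`m ≥ 1` largest coefficients of `x`, Chebyshev approximation to `x` from the span of
the basis vectors indexed by `Λ` has error at most `K * σ^w_{w(Λ)}(x)`. -/
def IsWSemiGreedy (b : SchauderBasis ℝ X) (w : ℕ → ℝ) : Prop :=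
  ∃ K : ℝ, ∀ (x : X) (Λ : Finset ℕ), Λ.Nonempty → IsGreedySet b x Λ →
    ∀ g : X, IsChebyshevApprox b x Λ g →
      ‖x - g‖ ≤ K * bestApproxError b w (wMeasure w Λ) x

/-- The basis is semi-greedy: it is `w`-semi-greedy for the constant weight `1`. -/
def IsSemiGreedy (b : SchauderBasis ℝ X) : Prop := IsWSemiGreedy b (fun _ => 1)

end

end

/-! Only one direction has content. Let `K` be the `w`-semi-greedy constant and `β` a bound for the
partial sum projections. Adding a flat block to the right of a finitely supported vector, choosing a
competitor and then projecting gives two comparisons: a block is controlled by any vector with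
larger coefficients on a greedy set of at least the block's weight (`norm_tail_le`), and a vector by
a constant block to its right that dominates it in coefficients and weight (`norm_head_le`).

Finite cotype makes some signed sum of many basis vectors large. Arbitrarily many tiny weights, or
one huge weight, would let a single basis vector control all such sums, so `c ≤ w ≤ M` with `c > 0`.

Weight and cardinality are then comparable up to `L ≥ M / c`. If `#A ≤ #Λ`, the part of `x` on `A \
Λ` is exchanged for a flat block `D` on the right of height `α`, the least coefficient of `x` on
`Λ`. The block is heavy enough for `w`-semi-greediness to apply, yet its norm is controlled by the
error `x - basisSum b A a`, whose coefficients on `Λ \ A` are still at least `α`. -/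

section

variable {X : Type*} [NormedAddCommGroup X] [NormedSpace ℝ X]

/-! ### Finite sums, coordinates and partial sum projections -/

/-- The vector `∑ n ∈ A, a n • e n` with coefficients `a` and support in `A`. -/
noncomputable def basisSum (b : SchauderBasis ℝ X) (A : Finset ℕ) (a : ℕ → ℝ) : X :=
  ∑ n ∈ A, a n • b.basis n

theorem coord_basisSum (b : SchauderBasis ℝ X) (A : Finset ℕ) (a : ℕ → ℝ) (k : ℕ) :
    b.coord k (basisSum b A a) = if k ∈ A then a k else 0 := by
  simp [basisSum, b.ortho, Pi.single_apply]

theorem basisSum_mem_span (b : SchauderBasis ℝ X) (A : Finset ℕ) (a : ℕ → ℝ) :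
    basisSum b A a ∈ Submodule.span ℝ (b.basis '' (A : Set ℕ)) :=
  Submodule.sum_mem _ fun i hi =>
    Submodule.smul_mem _ _ (Submodule.subset_span ⟨i, hi, rfl⟩)

theorem exists_eq_basisSum (b : SchauderBasis ℝ X) (A : Finset ℕ) {g : X}
    (hg : g ∈ Submodule.span ℝ (b.basis '' (A : Set ℕ))) : ∃ c, g = basisSum b A c := by
  rw [← GeneralSchauderBasis.range_proj_eq_span b] at hg
  obtain ⟨u, rfl⟩ := hg
  exact ⟨fun i => b.coord i u, by simp [basisSum]⟩

theorem basisSum_union (b : SchauderBasis ℝ X) {A B : Finset ℕ} (h : Disjoint A B) (a : ℕ → ℝ) :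
    basisSum b (A ∪ B) a = basisSum b A a + basisSum b B a :=
  sum_union h

theorem proj_basisSum_of_lt (b : SchauderBasis ℝ X) {A : Finset ℕ} {N : ℕ} (h : ∀ i ∈ A, i < N)
    (a : ℕ → ℝ) : b.proj N (basisSum b A a) = basisSum b A a := by
  rw [basisSum, map_sum]
  refine sum_congr rfl fun i hi => ?_
  rw [map_smul, b.proj_apply_basis_mem, if_pos (h i hi)]

theorem proj_basisSum_of_le (b : SchauderBasis ℝ X) {A : Finset ℕ} {N : ℕ} (h : ∀ i ∈ A, N ≤ i)
    (a : ℕ → ℝ) : b.proj N (basisSum b A a) = 0 := by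
  rw [basisSum, map_sum]
  refine sum_eq_zero fun i hi => ?_
  rw [map_smul, b.proj_apply_basis_mem, if_neg (h i hi).not_gt, smul_zero]

theorem coord_proj (b : SchauderBasis ℝ X) (N : ℕ) (x : X) (k : ℕ) :
    b.coord k (b.proj N x) = if k < N then b.coord k x else 0 := by
  have := coord_basisSum b (range N) (fun i => b.coord i x) k
  simpa [basisSum] using this

theorem coord_eq_zero_of_le (b : SchauderBasis ℝ X) {N : ℕ} {x : X} (hx : b.proj N x = x) {k : ℕ}
    (hk : N ≤ k) : b.coord k x = 0 := by
  rw [← hx, coord_proj, if_neg hk.not_gt]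

theorem abs_coord_le (b : SchauderBasis ℝ X) (hb : ∀ n, ‖b.basis n‖ = 1) {β : ℝ}
    (hβ : ∀ n x, ‖b.proj n x‖ ≤ β * ‖x‖) (k : ℕ) (x : X) : |b.coord k x| ≤ 2 * β * ‖x‖ := by
  have h : b.coord k x • b.basis k = b.proj (k + 1) x - b.proj k x := by
    simp [sum_range_succ]
  calc |b.coord k x| = ‖b.coord k x • b.basis k‖ := by rw [norm_smul, hb, mul_one, Real.norm_eq_abs]
    _ ≤ ‖b.proj (k + 1) x‖ + ‖b.proj k x‖ := by rw [h]; exact norm_sub_le _ _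
    _ ≤ 2 * β * ‖x‖ := by linarith [hβ (k + 1) x, hβ k x]

/-! ### Consequences of greedy approximation for a general weight -/

/-- `K` is a constant such that approximation from the span of a greedy set `Λ` is within a factor
`K` of approximation by vectors whose support has `w`-measure at most that of `Λ`. -/
def GreedyApproxConst (b : SchauderBasis ℝ X) (w : ℕ → ℝ) (K : ℝ) : Prop :=
  ∀ (x : X) (Λ : Finset ℕ), IsGreedySet b x Λ → ∀ (A : Finset ℕ) (a : ℕ → ℝ),
    wMeasure w A ≤ wMeasure w Λ → ∃ c : ℕ → ℝ, ‖x - basisSum b Λ c‖ ≤ K * ‖x - basisSum b A a‖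

theorem bestApproxError_le (b : SchauderBasis ℝ X) (w : ℕ → ℝ) {y : ℝ} (x : X) {A : Finset ℕ}
    (a : ℕ → ℝ) (hA : wMeasure w A ≤ y) : bestApproxError b w y x ≤ ‖x - basisSum b A a‖ :=
  csInf_le ⟨0, by rintro _ ⟨A, a, -, rfl⟩; exact norm_nonneg _⟩ ⟨A, a, hA, rfl⟩

theorem bestApproxError_nonneg (b : SchauderBasis ℝ X) (w : ℕ → ℝ) (y : ℝ) (x : X) :
    0 ≤ bestApproxError b w y x :=
  Real.sInf_nonneg (by rintro _ ⟨A, a, -, rfl⟩; exact norm_nonneg _)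

theorem IsWSemiGreedy.exists_greedyApproxConst {b : SchauderBasis ℝ X} {w : ℕ → ℝ}
    (hw : IsWeight w) (h : IsWSemiGreedy b w) : ∃ K, 1 ≤ K ∧ GreedyApproxConst b w K := by
  obtain ⟨K, hK⟩ := h
  refine ⟨max K 1, le_max_right _ _, fun x Λ hΛ A a hA => ?_⟩
  rcases Λ.eq_empty_or_nonempty with rfl | hne
  -- The definition of semi-greedy excludes the empty set. Positivity of `w` then leaves only `A =
  -- ∅`, and constant `1` suffices.
  · have hA0 : A = ∅ := by
      by_contra hA'
      have := sum_pos (fun i _ => hw i) (nonempty_iff_ne_empty.2 hA')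
      simp only [wMeasure, sum_empty] at hA
      linarith
    subst hA0
    exact ⟨a, le_mul_of_one_le_left (norm_nonneg _) (le_max_right _ _)⟩
  · obtain ⟨g, hg⟩ := exists_isChebyshevApprox b x Λ
    obtain ⟨c, rfl⟩ := exists_eq_basisSum b Λ hg.1
    refine ⟨c, (hK x Λ hne hΛ _ hg).trans ?_⟩
    calc K * bestApproxError b w (wMeasure w Λ) x
        ≤ max K 1 * bestApproxError b w (wMeasure w Λ) x :=
          mul_le_mul_of_nonneg_right (le_max_left _ _) (bestApproxError_nonneg b w _ x)
      _ ≤ max K 1 * ‖x - basisSum b A a‖ :=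
          mul_le_mul_of_nonneg_left (bestApproxError_le b w x a hA)
            (zero_le_one.trans (le_max_right _ _))

/-- A block far to the right is controlled by a vector with a greedy set of at least the same
weight and larger coefficients. -/
theorem GreedyApproxConst.norm_tail_le {b : SchauderBasis ℝ X} {w : ℕ → ℝ} {K β : ℝ}
    (h : GreedyApproxConst b w K) (hβ : ∀ n x, ‖b.proj n x‖ ≤ β * ‖x‖) (hβ0 : 0 ≤ β) {N : ℕ} {x : X}
    (hx : b.proj N x = x) {Λ D : Finset ℕ} (hΛ : IsGreedySet b x Λ) (hΛN : ∀ i ∈ Λ, i < N)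
    (hD : ∀ i ∈ D, N ≤ i) {α : ℝ} (hα : ∀ i ∈ Λ, α ≤ |b.coord i x|) {c : ℕ → ℝ}
    (hc : ∀ i ∈ D, |c i| ≤ α) (hw : wMeasure w D ≤ wMeasure w Λ) :
    ‖basisSum b D c‖ ≤ (1 + β) * (K * ‖x‖) := by
  have hg : IsGreedySet b (x + basisSum b D c) Λ := by
    intro n hn k hk
    have hnD : n ∉ D := fun hnD => (hΛN n hn).not_ge (hD n hnD)
    rw [map_add, map_add, coord_basisSum, coord_basisSum, if_neg hnD, add_zero]
    split_ifs with hkD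
    · rw [coord_eq_zero_of_le b hx (hD k hkD), zero_add]
      exact (hc k hkD).trans (hα n hn)
    · simpa using hΛ n hn k hk
  obtain ⟨d, hd⟩ := h _ Λ hg D c hw
  rw [add_sub_cancel_right] at hd
  set v := x + basisSum b D c - basisSum b Λ d with hv
  -- Subtracting the `N`-th partial sum removes both `x` and the correction on `Λ`.
  have hP : basisSum b D c = v - b.proj N v := by
    rw [hv, map_sub, map_add, hx, proj_basisSum_of_le b hD, proj_basisSum_of_lt b hΛN]
    abel
  calc ‖basisSum b D c‖ ≤ ‖v‖ + ‖b.proj N v‖ := by rw [hP]; exact norm_sub_le _ _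
    _ ≤ (1 + β) * ‖v‖ := by linarith [hβ N v]
    _ ≤ (1 + β) * (K * ‖x‖) := by gcongr

/-- A vector supported on an initial segment is controlled by a constant block to its right of at
least the same weight. -/
theorem GreedyApproxConst.norm_head_le {b : SchauderBasis ℝ X} {w : ℕ → ℝ} {K β : ℝ}
    (h : GreedyApproxConst b w K) (hβ : ∀ n x, ‖b.proj n x‖ ≤ β * ‖x‖) (hβ0 : 0 ≤ β) {N : ℕ}
    {A D : Finset ℕ} (hA : ∀ i ∈ A, i < N) (hD : ∀ i ∈ D, N ≤ i) {α : ℝ} (hα : 0 ≤ α) {a : ℕ → ℝ}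
    (ha : ∀ i ∈ A, |a i| ≤ α) (hw : wMeasure w A ≤ wMeasure w D) :
    ‖basisSum b A a‖ ≤ β * (K * ‖basisSum b D fun _ => α‖) := by
  have hg : IsGreedySet b (basisSum b A a + basisSum b D fun _ => α) D := by
    intro n hn k hk
    have hnA : n ∉ A := fun hnA => (hA n hnA).not_ge (hD n hn)
    rw [map_add, map_add, coord_basisSum, coord_basisSum, coord_basisSum, coord_basisSum,
      if_neg hnA, if_pos hn, if_neg hk, zero_add, add_zero, abs_of_nonneg hα]
    split_ifs with hkA
    · exact ha k hkA
    · simpa using hα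
  obtain ⟨d, hd⟩ := h _ D hg A a hw
  rw [add_sub_cancel_left] at hd
  have hP : basisSum b A a =
      b.proj N (basisSum b A a + (basisSum b D fun _ => α) - basisSum b D d) := by
    rw [map_sub, map_add, proj_basisSum_of_le b hD, proj_basisSum_of_le b hD,
      proj_basisSum_of_lt b hA, add_zero, sub_zero]
  rw [hP]
  exact (hβ _ _).trans (by gcongr)

/-- Approximation from the span of a greedy set `Λ` after removing the coefficients of `x` in
`A \ Λ`, where the weight of `A \ Λ` is compensated by a constant block to the right. -/
theorem GreedyApproxConst.exists_norm_sub_le {b : SchauderBasis ℝ X} {w : ℕ → ℝ} {K β : ℝ}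
    (h : GreedyApproxConst b w K) (hwt : ∀ i, 0 ≤ w i) (hK : 0 ≤ K)
    (hβ : ∀ n x, ‖b.proj n x‖ ≤ β * ‖x‖) (hβ0 : 0 ≤ β)
    {N : ℕ} {x : X} (hx : b.proj N x = x) {Λ A D : Finset ℕ} (hΛN : ∀ i ∈ Λ, i < N)
    (hAN : ∀ i ∈ A, i < N) (hD : ∀ i ∈ D, N ≤ i) {α : ℝ} (hα : 0 ≤ α)
    (hαΛ : ∀ i ∈ Λ, α ≤ |b.coord i x|) (hαΛ' : ∀ i ∉ Λ, |b.coord i x| ≤ α)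
    (hw : wMeasure w (A \ Λ) ≤ wMeasure w D) (a : ℕ → ℝ) :
    ∃ c : ℕ → ℝ, ‖x - basisSum b (A \ Λ) (fun i => b.coord i x) - basisSum b Λ c‖ ≤
      β * (K * (‖x - basisSum b A a‖ + ‖basisSum b D fun _ => α‖)) := by
  have hΛD : Disjoint Λ D := disjoint_left.2 fun i hi hi' => (hΛN i hi).not_ge (hD i hi')
  have hg : IsGreedySet b (x - basisSum b (A \ Λ) (fun i => b.coord i x) +
      basisSum b D fun _ => α) (Λ ∪ D) := by
    have hlow : ∀ n ∈ Λ ∪ D, α ≤ |b.coord n (x - basisSum b (A \ Λ) (fun i => b.coord i x) +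
        basisSum b D fun _ => α)| := by
      intro n hn
      rw [map_add, map_sub, coord_basisSum, coord_basisSum]
      rcases mem_union.1 hn with hn | hn
      · rw [if_neg (fun h' => (mem_sdiff.1 h').2 hn), if_neg (disjoint_left.1 hΛD hn)]
        simpa using hαΛ n hn
      · rw [if_neg (fun h' => (hAN n (mem_sdiff.1 h').1).not_ge (hD n hn)), if_pos hn,
          coord_eq_zero_of_le b hx (hD n hn)]
        simpa using le_abs_self α
    intro n hn k hk
    refine le_trans ?_ (hlow n hn)
    rw [mem_union, not_or] at hk
    rw [map_add, map_sub, coord_basisSum, coord_basisSum, if_neg hk.2]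
    split_ifs
    · simpa using hα
    · simpa using hαΛ' k hk.1
  have hwA : wMeasure w A ≤ wMeasure w (Λ ∪ D) := by
    have h1 : wMeasure w A = wMeasure w (A \ Λ) + wMeasure w (A ∩ Λ) :=
      ((add_comm _ _).trans (sum_inter_add_sum_sdiff A Λ w)).symm
    have h2 : wMeasure w (A ∩ Λ) ≤ wMeasure w Λ :=
      sum_le_sum_of_subset_of_nonneg inter_subset_right fun i _ _ => hwt i
    have h3 : wMeasure w (Λ ∪ D) = wMeasure w Λ + wMeasure w D := sum_union hΛD
    linarith
  -- These coefficients make up for the deleted part, so that the competitor's error is `x -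
  -- basisSum b A a` plus the block.
  obtain ⟨d, hd⟩ := h _ _ hg A (fun i => a i - if i ∈ A \ Λ then b.coord i x else 0) hwA
  refine ⟨d, ?_⟩
  have hA' : basisSum b A (fun i => a i - if i ∈ A \ Λ then b.coord i x else 0) =
      basisSum b A a - basisSum b (A \ Λ) (fun i => b.coord i x) := by
    simp only [basisSum, sub_smul, sum_sub_distrib, ite_smul, zero_smul, sum_ite_mem]
    rw [inter_eq_right.2 sdiff_subset]
  have hsub : x - basisSum b (A \ Λ) (fun i => b.coord i x) + (basisSum b D fun _ => α) -
      (basisSum b A a - basisSum b (A \ Λ) (fun i => b.coord i x)) =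
      (x - basisSum b A a) + basisSum b D fun _ => α := by abel
  rw [hA', hsub] at hd
  have hP : x - basisSum b (A \ Λ) (fun i => b.coord i x) - basisSum b Λ d =
      b.proj N (x - basisSum b (A \ Λ) (fun i => b.coord i x) + (basisSum b D fun _ => α) -
        basisSum b (Λ ∪ D) d) := by
    rw [basisSum_union b hΛD, map_sub, map_add, map_add, map_sub, hx, proj_basisSum_of_le b hD,
      proj_basisSum_of_le b hD, proj_basisSum_of_lt b hΛN,
      proj_basisSum_of_lt b fun i hi => hAN i (mem_sdiff.1 hi).1, add_zero, add_zero]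
  rw [hP]
  refine (hβ _ _).trans ?_
  gcongr
  exact hd.trans (by gcongr; exact norm_add_le _ _)

theorem norm_sum_le_of_card_le_mul {E : Type*} [SeminormedAddCommGroup E] {v : ℕ → E} {s : ℕ}
    {B : ℝ} (L : ℕ) :
    ∀ D : Finset ℕ, (∀ D' ⊆ D, #D' ≤ s → ‖∑ i ∈ D', v i‖ ≤ B) → #D ≤ L * s →
      ‖∑ i ∈ D, v i‖ ≤ L * B := by
  induction L with
  | zero => intro D _ hD; simp_all
  | succ L ih =>
    intro D hD hcard
    obtain ⟨D', hD', hc⟩ := exists_subset_card_eq (min_le_right s #D)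
    have h2 : #(D \ D') ≤ L * s := by
      rw [card_sdiff_of_subset hD', hc]
      rw [add_mul, one_mul] at hcard
      omega
    rw [← sum_sdiff hD']
    refine (norm_add_le _ _).trans ?_
    have h3 := ih (D \ D') (fun E hE => hD E (hE.trans sdiff_subset)) h2
    have h4 := hD D' hD' (by omega)
    push_cast
    linarith

/-! ### Finite cotype forces two-sided bounds on the weight -/

/-- In a space of finite cotype, long families of unit vectors have some large signed sum. -/
theorem HasFiniteCotype.exists_lt_norm_sum (hX : HasFiniteCotype X) (B : ℝ) :
    ∃ n : ℕ, ∀ x : Fin n → X, (∀ j, ‖x j‖ = 1) →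
      ∃ ε : Fin n → ℤˣ, B < ‖∑ j, ((ε j : ℤ) : ℝ) • x j‖ := by
  obtain ⟨q, hq, C, hC⟩ := hX
  have hq0 : 0 < q := by linarith
  -- If every signed sum had norm at most `B`, cotype would give `n ^ (1 / q) ≤ |C| * |B|`.
  obtain ⟨n, hn⟩ := exists_nat_gt ((|C| * |B|) ^ q)
  refine ⟨n, fun x hx => ?_⟩
  by_contra! hcon
  have h := hC n x
  simp only [hx, Real.one_rpow, sum_const, card_univ, Fintype.card_fin, nsmul_eq_mul, mul_one] at h
  have hsum : (∑ ε : Fin n → ℤˣ, ‖∑ j, ((ε j : ℤ) : ℝ) • x j‖ ^ q) / (2 : ℝ) ^ n ≤ |B| ^ q := by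
    rw [div_le_iff₀ (by positivity)]
    calc ∑ ε : Fin n → ℤˣ, ‖∑ j, ((ε j : ℤ) : ℝ) • x j‖ ^ q
        ≤ ∑ _ε : Fin n → ℤˣ, |B| ^ q := sum_le_sum fun ε _ =>
          Real.rpow_le_rpow (norm_nonneg _) ((hcon ε).trans (le_abs_self B)) hq0.le
      _ = |B| ^ q * 2 ^ n := by simp [mul_comm]
  have hnn : 0 ≤ (∑ ε : Fin n → ℤˣ, ‖∑ j, ((ε j : ℤ) : ℝ) • x j‖ ^ q) / (2 : ℝ) ^ n := by
    positivity
  have h2 : ((∑ ε : Fin n → ℤˣ, ‖∑ j, ((ε j : ℤ) : ℝ) • x j‖ ^ q) / (2 : ℝ) ^ n) ^ (1 / q)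
      ≤ |B| := by
    refine (Real.rpow_le_rpow hnn hsum (by positivity)).trans_eq ?_
    rw [← Real.rpow_mul (abs_nonneg B), mul_one_div_cancel hq0.ne', Real.rpow_one]
  have h3 : (n : ℝ) ^ (1 / q) ≤ |C| * |B| :=
    h.trans (mul_le_mul (le_abs_self C) h2 (Real.rpow_nonneg hnn _) (abs_nonneg C))
  have h4 : (n : ℝ) ≤ (|C| * |B|) ^ q := by
    refine le_trans (le_of_eq ?_) (Real.rpow_le_rpow (by positivity) h3 hq0.le)
    rw [← Real.rpow_mul (by positivity), one_div_mul_cancel hq0.ne', Real.rpow_one]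
  linarith

/-- In a space of finite cotype, signed sums of sufficiently many elements of a normalized basis
cannot all be bounded by a given constant. -/
theorem HasFiniteCotype.exists_lt_norm_basisSum (hX : HasFiniteCotype X) (b : SchauderBasis ℝ X)
    (hb : ∀ n, ‖b.basis n‖ = 1) (B : ℝ) :
    ∃ n : ℕ, ∀ A : Finset ℕ, #A = n →
      ∃ a : ℕ → ℝ, (∀ i, |a i| ≤ 1) ∧ B < ‖basisSum b A a‖ := by
  obtain ⟨n, hn⟩ := hX.exists_lt_norm_sum B
  refine ⟨n, fun A hA => ?_⟩
  obtain ⟨ε, hε⟩ := hn (fun j => b.basis (A.orderEmbOfFin hA j)) fun j => hb _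
  have hinj : Function.Injective (A.orderEmbOfFin hA) := (A.orderEmbOfFin hA).injective
  refine ⟨Function.extend (A.orderEmbOfFin hA) (fun j => ((ε j : ℤ) : ℝ)) 0, fun i => ?_, ?_⟩
  · by_cases hi : ∃ j, A.orderEmbOfFin hA j = i
    · obtain ⟨j, rfl⟩ := hi
      rw [hinj.extend_apply]
      rcases Int.units_eq_one_or (ε j) with h | h <;> simp [h]
    · simp [Function.extend_apply' _ _ _ hi]
  · convert hε using 2
    refine (sum_congr (by rw [map_orderEmbOfFin_univ]) fun _ _ => rfl).trans
      ((sum_map univ (A.orderEmbOfFin hA).toEmbedding _).trans ?_)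
    exact sum_congr rfl fun j _ => by simp [hinj.extend_apply]

/-- In a space of finite cotype, the weight is bounded away from zero. -/
theorem GreedyApproxConst.exists_pos_le {b : SchauderBasis ℝ X} {w : ℕ → ℝ} {K β : ℝ}
    (hX : HasFiniteCotype X) (hb : ∀ n, ‖b.basis n‖ = 1) (hw : IsWeight w)
    (h : GreedyApproxConst b w K) (hβ : ∀ n x, ‖b.proj n x‖ ≤ β * ‖x‖) (hβ0 : 0 ≤ β) :
    ∃ c, 0 < c ∧ ∀ i, c ≤ w i := by
  obtain ⟨n, hn⟩ := hX.exists_lt_norm_basisSum b hb ((1 + β) * K)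
  -- Any `n` indices of weight below `δ` weigh at most `w 0` together, so `e_0` with greedy set
  -- `{0}` controls their signed sums. Hence only finitely many weights lie below `δ`.
  set δ := w 0 / (n + 1) with hδ
  have hδ0 : 0 < δ := div_pos (hw 0) (by positivity)
  have hfin : {i | w i < δ}.Finite := by
    by_contra hinf
    obtain ⟨A, hA, hAn⟩ :=
      ((show {i | w i < δ}.Infinite from hinf).sdiff (Set.finite_singleton 0)).exists_subset_card_eq n
    obtain ⟨a, ha, hlt⟩ := hn A hAn
    refine hlt.not_ge ?_
    have hcoord : ∀ i, b.coord i (b.basis 0) = if i = 0 then 1 else 0 := fun i => by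
      simp [b.ortho, Pi.single_apply]
    have := h.norm_tail_le (N := 1) (x := b.basis 0) (Λ := {0}) (D := A) (α := 1) (c := a) hβ hβ0
      (by rw [b.proj_apply_basis_mem]; simp)
      (by
        intro i hi k hk
        rw [mem_singleton] at hi hk
        simp [hcoord, hi, hk])
      (by simp)
      (fun i hi => Nat.one_le_iff_ne_zero.2 (hA hi).2)
      (by simp [hcoord]) (fun i _ => ha i)
      (by
        have h1 : wMeasure w A ≤ #A • δ := sum_le_card_nsmul _ _ _ fun i hi => (hA hi).1.le
        have h2 : (n : ℝ) * δ ≤ w 0 := by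
          rw [hδ, mul_div_assoc', div_le_iff₀ (by positivity)]
          nlinarith [hw 0]
        rw [hAn, nsmul_eq_mul] at h1
        simpa [wMeasure] using h1.trans h2)
    simpa [hb] using this
  rcases hfin.toFinset.eq_empty_or_nonempty with he | hne
  · refine ⟨δ, hδ0, fun i => not_lt.1 fun hi => ?_⟩
    have : i ∈ hfin.toFinset := by simpa using hi
    simp [he] at this
  · obtain ⟨j, hj, hmin⟩ := exists_min_image hfin.toFinset w hne
    refine ⟨w j, hw j, fun i => ?_⟩
    rw [Set.Finite.mem_toFinset, Set.mem_ofPred_eq] at hj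
    by_cases hi : w i < δ
    · exact hmin i (by simpa using hi)
    · linarith

/-- In a space of finite cotype, the weight is bounded. -/
theorem GreedyApproxConst.exists_le {b : SchauderBasis ℝ X} {w : ℕ → ℝ} {K β : ℝ}
    (hX : HasFiniteCotype X) (hb : ∀ n, ‖b.basis n‖ = 1) (hw : IsWeight w)
    (h : GreedyApproxConst b w K) (hβ : ∀ n x, ‖b.proj n x‖ ≤ β * ‖x‖) (hβ0 : 0 ≤ β) :
    ∃ M, ∀ i, w i ≤ M := by
  obtain ⟨n, hn⟩ := hX.exists_lt_norm_basisSum b hb (β * K)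
  -- If `w j` exceeded this total, the single vector `e_j` would control every signed sum over
  -- `range n`.
  refine ⟨wMeasure w (range n), fun j => ?_⟩
  rcases lt_or_ge j n with hj | hj
  · exact single_le_sum (f := w) (fun i _ => (hw i).le) (mem_range.2 hj)
  · by_contra! hlt
    obtain ⟨a, ha, hBa⟩ := hn (range n) (card_range n)
    refine hBa.not_ge ?_
    have := h.norm_head_le (N := n) (A := range n) (D := {j}) (α := 1) (a := a) hβ hβ0
      (fun i => mem_range.1) (by simpa using hj) zero_le_one (fun i _ => ha i)
      (by simpa [wMeasure] using hlt.le)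
    simpa [basisSum, hb] using this

/-! ### From a bounded weight to cardinality -/

/-- For a weight bounded above and below, a constant block to the right is controlled by a vector
with sufficiently many large coefficients. -/
theorem GreedyApproxConst.norm_const_tail_le {b : SchauderBasis ℝ X} {w : ℕ → ℝ} {K β c M : ℝ}
    {L : ℕ} (hb : ∀ n, ‖b.basis n‖ = 1) (h : GreedyApproxConst b w K) (hK : 0 ≤ K)
    (hβ : ∀ n x, ‖b.proj n x‖ ≤ β * ‖x‖) (hβ0 : 0 ≤ β) (hc : 0 < c)
    (hcw : ∀ i, c ≤ w i) (hwM : ∀ i, w i ≤ M) (hL : M ≤ c * L)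
    {N : ℕ} {z : X} (hz : b.proj N z = z) {G : Finset ℕ} (hGN : ∀ i ∈ G, i < N) {α : ℝ}
    (hα : 0 ≤ α) (hG : ∀ i ∈ G, α ≤ |b.coord i z|) {D : Finset ℕ} (hD : ∀ i ∈ D, N ≤ i)
    (hDG : #D ≤ L * #G) :
    ‖basisSum b D fun _ => α‖ ≤ (L * L : ℕ) * ((1 + β) * (K * ‖z‖) + 2 * β * ‖z‖) := by
  have hB : 0 ≤ (1 + β) * (K * ‖z‖) + 2 * β * ‖z‖ := by positivity
  rcases G.eq_empty_or_nonempty with rfl | ⟨i₀, hi₀⟩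
  · have : D = ∅ := by simpa using hDG
    subst this
    simpa [basisSum] using mul_nonneg (mul_self_nonneg (L : ℝ)) hB
  have hL0 : 0 < L := by
    by_contra h0
    have : L = 0 := by omega
    subst this
    have := (hcw 0).trans ((hwM 0).trans hL)
    simp at this
    linarith
  have hαz : α ≤ 2 * β * ‖z‖ := (hG i₀ hi₀).trans (abs_coord_le b hb hβ i₀ z)
  -- `G` need not be greedy for `z`, but the set of all indices below `N` with coefficient at least
  -- `α` is, and it contains `G`.
  let G' := (range N).filter fun i => α ≤ |b.coord i z|
  have hGG' : G ⊆ G' := fun i hi => mem_filter.2 ⟨mem_range.2 (hGN i hi), hG i hi⟩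
  have hG'g : IsGreedySet b z G' := by
    intro n hn k hk
    refine le_trans ?_ (mem_filter.1 hn).2
    rcases lt_or_ge k N with hkN | hkN
    · by_contra! hlt
      exact hk (mem_filter.2 ⟨mem_range.2 hkN, hlt.le⟩)
    · rwa [coord_eq_zero_of_le b hz hkN, abs_zero]
  have hsmall : ∀ D' ⊆ D, #D' ≤ #G / L →
      ‖basisSum b D' fun _ => α‖ ≤ (1 + β) * (K * ‖z‖) := by
    intro D' hD' hcard
    refine h.norm_tail_le hβ hβ0 hz hG'g (fun i hi => mem_range.1 (mem_filter.1 hi).1)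
      (fun i hi => hD i (hD' hi)) (fun i hi => (mem_filter.1 hi).2)
      (fun i _ => (abs_of_nonneg hα).le) ?_
    have h1 : wMeasure w D' ≤ #D' • M := sum_le_card_nsmul _ _ _ fun i _ => hwM i
    have h2 : #G' • c ≤ wMeasure w G' := card_nsmul_le_sum _ _ _ fun i _ => hcw i
    have h3 : ((#D' * L : ℕ) : ℝ) ≤ #G' := by
      exact_mod_cast ((Nat.le_div_iff_mul_le hL0).1 hcard).trans (card_le_card hGG')
    rw [nsmul_eq_mul] at h1 h2
    push_cast at h3
    calc wMeasure w D' ≤ #D' * M := h1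
      _ ≤ #D' * (c * L) := by gcongr
      _ = (#D' * L) * c := by ring
      _ ≤ #G' * c := by gcongr
      _ ≤ wMeasure w G' := h2
  -- The floor `#G / L` may be zero, so pieces get one extra vector, of norm `α ≤ 2 * β * ‖z‖`. Then
  -- `L * L` pieces suffice, as `#D ≤ L * #G ≤ L * L * (#G / L + 1)`.
  refine norm_sum_le_of_card_le_mul (s := #G / L + 1) (L * L) D (fun D' hD' hcard => ?_) ?_
  · rcases D'.eq_empty_or_nonempty with rfl | ⟨j, hj⟩
    · simpa using hB
    · rw [← add_sum_erase _ _ hj, add_comm]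
      refine (norm_add_le _ _).trans (add_le_add ?_ ?_)
      · refine hsmall (D'.erase j) ((erase_subset _ _).trans hD') ?_
        rw [card_erase_of_mem hj]
        exact Nat.sub_le_of_le_add hcard
      · rwa [norm_smul, hb, mul_one, Real.norm_eq_abs, abs_of_nonneg hα]
  · refine hDG.trans ?_
    rw [mul_assoc]
    gcongr
    exact (Nat.lt_mul_div_succ _ hL0).le

/-- Support below `N` leaves room for the block `D`. The error splits in two: with the `A \ Λ` part
of `x` deleted, `exists_norm_sub_le` applies; the deleted part is bounded by the block through
`norm_head_le`. -/
theorem GreedyApproxConst.exists_approx_of_proj_eq {b : SchauderBasis ℝ X} {w : ℕ → ℝ}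
    {K β c M : ℝ} {L : ℕ} (hb : ∀ n, ‖b.basis n‖ = 1) (h : GreedyApproxConst b w K) (hK : 1 ≤ K)
    (hβ : ∀ n x, ‖b.proj n x‖ ≤ β * ‖x‖) (hβ1 : 1 ≤ β) (hc : 0 < c)
    (hcw : ∀ i, c ≤ w i) (hwM : ∀ i, w i ≤ M) (hL : M ≤ c * L) :
    ∃ C, 0 < C ∧ ∀ (N : ℕ) (x : X), b.proj N x = x → ∀ Λ A : Finset ℕ, (∀ i ∈ Λ, i < N) →
      (∀ i ∈ A, i < N) → IsGreedySet b x Λ → #A ≤ #Λ → ∀ a : ℕ → ℝ,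
      ∃ d : ℕ → ℝ, ‖x - basisSum b Λ d‖ ≤ C * ‖x - basisSum b A a‖ := by
  have hβ0 : 0 ≤ β := by linarith
  have hK0 : 0 ≤ K := by linarith
  set T : ℝ := (L * L : ℕ) * ((1 + β) * K + 2 * β) with hT
  have hT0 : 0 ≤ T := by positivity
  refine ⟨β * K * (1 + T) + β * K * T, by positivity, fun N x hx Λ A hΛN hAN hΛ hcard a => ?_⟩
  rcases Λ.eq_empty_or_nonempty with rfl | hne
  · have hA : A = ∅ := by simpa using hcard
    subst hA
    refine ⟨a, le_mul_of_one_le_left (norm_nonneg _) ?_⟩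
    nlinarith [one_le_mul_of_one_le_of_one_le hβ1 hK]
  obtain ⟨m, hm, hmin⟩ := exists_min_image Λ (fun i => |b.coord i x|) hne
  set α := |b.coord m x| with hα
  have hα0 : 0 ≤ α := abs_nonneg _
  have hEΛ : #(A \ Λ) ≤ #(Λ \ A) := card_sdiff_le_card_sdiff_iff.2 hcard
  -- Since `M ≤ c * L`, this length gives `w(D) ≥ w(A \ Λ)`. It is also at most `L * #(Λ \ A)`, as
  -- bounding the block by `z` requires.
  set D := Ico N (N + L * #(A \ Λ)) with hDdef
  have hDN : ∀ i ∈ D, N ≤ i := fun i hi => (mem_Ico.1 hi).1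
  have hDcard : #D = L * #(A \ Λ) := by simp [hDdef]
  set z := x - basisSum b A a with hz
  have hzN : b.proj N z = z := by rw [hz, map_sub, hx, proj_basisSum_of_lt b hAN]
  have hwD : wMeasure w (A \ Λ) ≤ wMeasure w D := by
    have h1 : wMeasure w (A \ Λ) ≤ #(A \ Λ) • M := sum_le_card_nsmul _ _ _ fun i _ => hwM i
    have h2 : #D • c ≤ wMeasure w D := card_nsmul_le_sum _ _ _ fun i _ => hcw i
    rw [nsmul_eq_mul] at h1 h2
    rw [hDcard] at h2
    push_cast at h2
    calc wMeasure w (A \ Λ) ≤ #(A \ Λ) * M := h1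
      _ ≤ #(A \ Λ) * (c * L) := by gcongr
      _ = L * #(A \ Λ) * c := by ring
      _ ≤ wMeasure w D := h2
  have hblock : ‖basisSum b D fun _ => α‖ ≤ T * ‖z‖ := by
    refine (h.norm_const_tail_le hb hK0 hβ hβ0 hc hcw hwM hL hzN (G := Λ \ A)
      (fun i hi => hΛN i (mem_sdiff.1 hi).1) hα0 (fun i hi => ?_) hDN ?_).trans_eq ?_
    · rw [hz, map_sub, coord_basisSum, if_neg (mem_sdiff.1 hi).2, sub_zero]
      exact hmin i (mem_sdiff.1 hi).1
    · rw [hDcard]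
      gcongr
    · rw [hT]; ring
  have hoff : ∀ i ∉ Λ, |b.coord i x| ≤ α := fun i hi => hΛ m hm i hi
  obtain ⟨d, hd⟩ := h.exists_norm_sub_le (fun i => hc.le.trans (hcw i)) hK0 hβ hβ0 hx hΛN hAN hDN
    hα0 hmin hoff hwD a
  have hE := h.norm_head_le hβ hβ0 (fun i hi => hAN i (mem_sdiff.1 hi).1) hDN hα0
    (fun i hi => hoff i (mem_sdiff.1 hi).2) hwD
  refine ⟨d, ?_⟩
  calc ‖x - basisSum b Λ d‖
      = ‖(x - basisSum b (A \ Λ) (fun i => b.coord i x) - basisSum b Λ d) +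
          basisSum b (A \ Λ) (fun i => b.coord i x)‖ := by congr 1; abel
    _ ≤ β * (K * (‖z‖ + ‖basisSum b D fun _ => α‖)) + β * (K * ‖basisSum b D fun _ => α‖) :=
        (norm_add_le _ _).trans (add_le_add hd hE)
    _ ≤ β * (K * (‖z‖ + T * ‖z‖)) + β * (K * (T * ‖z‖)) := by gcongr
    _ = (β * K * (1 + T) + β * K * T) * ‖z‖ := by ring

/-- A basis that is semi-greedy for a weight bounded above and below is semi-greedy. -/
theorem GreedyApproxConst.isSemiGreedy {b : SchauderBasis ℝ X} {w : ℕ → ℝ}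
    {K β c M : ℝ} (hb : ∀ n, ‖b.basis n‖ = 1) (h : GreedyApproxConst b w K) (hK : 1 ≤ K)
    (hβ : ∀ n x, ‖b.proj n x‖ ≤ β * ‖x‖) (hβ1 : 1 ≤ β) (hc : 0 < c)
    (hcw : ∀ i, c ≤ w i) (hwM : ∀ i, w i ≤ M) : IsSemiGreedy b := by
  obtain ⟨L, hL⟩ := exists_nat_ge (M / c)
  rw [div_le_iff₀' hc] at hL
  obtain ⟨C, hC, hmain⟩ := h.exists_approx_of_proj_eq hb hK hβ hβ1 hc hcw hwM hL
  have hCβ : 0 < C * β := by positivity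
  refine ⟨C * β, fun x Λ _ hΛ g hg => ?_⟩
  rw [← div_le_iff₀' hCβ]
  refine le_csInf ⟨_, ∅, 0, by simp [wMeasure], rfl⟩ ?_
  rintro _ ⟨A, a, hA, rfl⟩
  rw [div_le_iff₀' hCβ]
  have hcard : #A ≤ #Λ := by simpa [wMeasure] using hA
  -- The finitely supported case applies to `b.proj N x`, where `Λ` stays greedy. Passing back costs
  -- a factor `β` and an error that vanishes as `N → ∞`.
  have hlim : Filter.Tendsto (fun N => C * β * ‖x - basisSum b A a‖ + ‖x - b.proj N x‖)
      Filter.atTop (nhds (C * β * ‖x - basisSum b A a‖)) := by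
    simpa using ((b.tendsto_proj x).const_sub x).norm.const_add (C * β * ‖x - basisSum b A a‖)
  refine ge_of_tendsto hlim ?_
  filter_upwards [Filter.eventually_gt_atTop ((A ∪ Λ).sup id)] with N hN
  have hlt : ∀ i ∈ A ∪ Λ, i < N := fun i hi => (le_sup (f := id) hi).trans_lt hN
  have hAN : ∀ i ∈ A, i < N := fun i hi => hlt i (mem_union_left _ hi)
  have hΛN : ∀ i ∈ Λ, i < N := fun i hi => hlt i (mem_union_right _ hi)
  have hΛ' : IsGreedySet b (b.proj N x) Λ := by
    intro n hn k hk
    rw [coord_proj, coord_proj, if_pos (hΛN n hn)]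
    split_ifs
    · exact hΛ n hn k hk
    · simp
  obtain ⟨d, hd⟩ := hmain N (b.proj N x) (by rw [b.proj_comp, min_self]) Λ A hΛN hAN hΛ' hcard a
  have hz : b.proj N x - basisSum b A a = b.proj N (x - basisSum b A a) := by
    rw [map_sub, proj_basisSum_of_lt b hAN]
  calc ‖x - g‖ ≤ ‖x - basisSum b Λ d‖ := hg.2 _ (basisSum_mem_span b Λ d)
    _ = ‖(b.proj N x - basisSum b Λ d) + (x - b.proj N x)‖ := by congr 1; abel
    _ ≤ C * ‖b.proj N x - basisSum b A a‖ + ‖x - b.proj N x‖ :=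
        (norm_add_le _ _).trans (add_le_add_left hd _)
    _ ≤ C * (β * ‖x - basisSum b A a‖) + ‖x - b.proj N x‖ := by
        rw [hz]
        gcongr
        exact hβ _ _
    _ = C * β * ‖x - basisSum b A a‖ + ‖x - b.proj N x‖ := by ring

end

theorem mainTheorem4 {X : Type*} [NormedAddCommGroup X] [NormedSpace ℝ X] [CompleteSpace X]
    (hX : HasFiniteCotype X) (b : SchauderBasis ℝ X) (hb : ∀ n, ‖b.basis n‖ = 1) :
    (∃ w : ℕ → ℝ, IsWeight w ∧ IsWSemiGreedy b w) ↔ IsSemiGreedy b := by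
  refine ⟨?_, fun h => ⟨fun _ => 1, fun _ => one_pos, h⟩⟩
  rintro ⟨w, hw, h⟩
  obtain ⟨K, hK, hG⟩ := h.exists_greedyApproxConst hw
  obtain ⟨β, hβ⟩ := b.exists_norm_proj_le
  have hproj : ∀ n x, ‖b.proj n x‖ ≤ max β 1 * ‖x‖ := fun n x =>
    (b.proj n).le_of_opNorm_le ((hβ n).trans (le_max_left _ _)) x
  have hβ1 : 1 ≤ max β 1 := le_max_right _ _
  have hβ0 : 0 ≤ max β 1 := zero_le_one.trans hβ1
  obtain ⟨c, hc, hcw⟩ := hG.exists_pos_le hX hb hw hproj hβ0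
  obtain ⟨M, hwM⟩ := hG.exists_le hX hb hw hproj hβ0
  exact hG.isSemiGreedy hb hK hproj hβ1 hc hcw hwM
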